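/- Let $3\le d_1<d_2<d_3$ be integers with $\gcd(d_1,d_2,d_3)=1$, none of which is a nonnegative integer combination of the other two, and let $S_3=\langle d_1,d_2,d_3\rangle\subseteq\mathbb{Z}_{\ge 0}$ be the numerical semigroup they generate ($0\in S_3$). Let $\Delta_3=\mathbb{Z}_{>0}\setminus S_3$ be its set of gaps, $F_3=\max\Delta_3$, $G_r=\sum_{s\in\Delta_3}s^r$, $\sigma_k=d_1^k+d_2^k+d_3^k$, $\delta_k=(\sigma_k-1)/2^k$, and put $$K_0=G_0+\delta_1,\qquad K_1=G_1+\frac{\sigma_1}{2}G_0+\frac{3\delta_1^2+\delta_2}{6},$$ $$g_3=F_3+\sigma_1,\qquad h_0=\frac{K_0}{g_3},\qquad h_1=\frac{K_1}{g_3^2},\qquad v=\frac{d_1d_2d_3}{g_3^2}.$$ Call integers $x_1,x_2,x_3,y,g$ with $0\le x_1,x_2,x_3,y<g$ \emph{syzygy degrees} of $S_3$ if $$\sum_{s\in S_3}t^s=\frac{1-t^{x_1}-t^{x_2}-t^{x_3}+t^{y}+t^{g}}{(1-t^{d_1})(1-t^{d_2})(1-t^{d_3})}.$$ Then syzygy degrees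 with $x_1,x_2,x_3,y>0$ exist; and for all syzygy degrees $x_1,x_2,x_3,y,g$ one has $g=g_3$ and, with $Y_1=y+g_3$ and $u=Y_1/g_3$, $$12h_1=2u(2h_0-1)+2-v.$$ Moreover $$\frac{5}{36}<h_1<\frac{11}{54}.$$ -/

import Mathlib

noncomputable section

namespace ThreeGen

/-- The semigroup `⟨d₁, d₂, d₃⟩ ⊆ ℕ` (containing `0`). -/
def semigroup (d₁ d₂ d₃ : ℕ) : AddSubmonoid ℕ :=
  AddSubmonoid.closure {d₁, d₂, d₃}

/-- `S₃ = ⟨d₁, d₂, d₃⟩` is a numerical semigroup (the generators have greatest common divisor `1`),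
the generators are listed in increasing order, and none of them is a nonnegative integer
combination of the other two. -/
structure IsMinimallyGenerated (d₁ d₂ d₃ : ℕ) : Prop where
  gcd_eq_one : Nat.gcd (Nat.gcd d₁ d₂) d₃ = 1
  three_le : 3 ≤ d₁
  lt₁₂ : d₁ < d₂
  lt₂₃ : d₂ < d₃
  notMem₁ : d₁ ∉ AddSubmonoid.closure ({d₂, d₃} : Set ℕ)
  notMem₂ : d₂ ∉ AddSubmonoid.closure ({d₁, d₃} : Set ℕ)
  notMem₃ : d₃ ∉ AddSubmonoid.closure ({d₁, d₂} : Set ℕ)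

/-- The set `Δ₃` of gaps: the positive integers outside the semigroup. -/
def gaps (d₁ d₂ d₃ : ℕ) : Set ℕ :=
  {s | 0 < s ∧ s ∉ semigroup d₁ d₂ d₃}

/-- The genera `G_r = ∑_{s ∈ Δ₃} s ^ r`; in particular `G_0` is the number of gaps. -/
def G (d₁ d₂ d₃ r : ℕ) : ℝ :=
  ∑ᶠ s ∈ gaps d₁ d₂ d₃, (s : ℝ) ^ r

/-- The Frobenius number `F₃`, the largest gap. -/
def frobenius (d₁ d₂ d₃ : ℕ) : ℕ :=
  sSup (gaps d₁ d₂ d₃)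

/-- The power sums `σ_k = d₁ ^ k + d₂ ^ k + d₃ ^ k`. -/
def sigma (d₁ d₂ d₃ k : ℕ) : ℝ :=
  (d₁ : ℝ) ^ k + (d₂ : ℝ) ^ k + (d₃ : ℝ) ^ k

/-- `δ_k = (σ_k - 1) / 2 ^ k`. -/
def delta (d₁ d₂ d₃ k : ℕ) : ℝ :=
  (sigma d₁ d₂ d₃ k - 1) / 2 ^ k

/-- `K_0 = G_0 + δ_1`. -/
def K0 (d₁ d₂ d₃ : ℕ) : ℝ :=
  G d₁ d₂ d₃ 0 + delta d₁ d₂ d₃ 1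

/-- `K_1 = G_1 + (σ_1 / 2) G_0 + (3 δ_1 ^ 2 + δ_2) / 6`. -/
def K1 (d₁ d₂ d₃ : ℕ) : ℝ :=
  G d₁ d₂ d₃ 1 + sigma d₁ d₂ d₃ 1 / 2 * G d₁ d₂ d₃ 0
    + (3 * delta d₁ d₂ d₃ 1 ^ 2 + delta d₁ d₂ d₃ 2) / 6

/-- `g₃ = F₃ + d₁ + d₂ + d₃`. -/
def g3 (d₁ d₂ d₃ : ℕ) : ℕ :=
  frobenius d₁ d₂ d₃ + (d₁ + d₂ + d₃)

/-- The rescaled genus `h_0 = K_0 / g₃`. -/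
def h0 (d₁ d₂ d₃ : ℕ) : ℝ :=
  K0 d₁ d₂ d₃ / (g3 d₁ d₂ d₃ : ℝ)

/-- The rescaled genus `h_1 = K_1 / g₃ ^ 2`. -/
def h1 (d₁ d₂ d₃ : ℕ) : ℝ :=
  K1 d₁ d₂ d₃ / (g3 d₁ d₂ d₃ : ℝ) ^ 2

/-- `v = d₁ d₂ d₃ / g₃ ^ 2`. -/
def v (d₁ d₂ d₃ : ℕ) : ℝ :=
  ((d₁ : ℝ) * d₂ * d₃) / (g3 d₁ d₂ d₃ : ℝ) ^ 2

open Classical in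
/-- The Hilbert series `∑_{s ∈ S₃} t ^ s`, as a formal power series. -/
def hilbertSeries (d₁ d₂ d₃ : ℕ) : PowerSeries ℤ :=
  PowerSeries.mk fun s => if s ∈ semigroup d₁ d₂ d₃ then 1 else 0

open PowerSeries in
/-- `x₁, x₂, x₃` and `y, g` are degrees of syzygies of `⟨d₁, d₂, d₃⟩`, with `g` the largest one:
`0 ≤ x_j, y < g` and the Hilbert series equals
`(1 - t^x₁ - t^x₂ - t^x₃ + t^y + t^g) / ((1 - t^d₁) (1 - t^d₂) (1 - t^d₃))`.
If the semigroup is symmetric, this covers every way to complete the numerator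
`1 - t^a - t^b + t^g` by a cancelling pair `x_j = y` (including `x_j = y = 0`). -/
structure IsSyzygyDegrees (d₁ d₂ d₃ x₁ x₂ x₃ y g : ℕ) : Prop where
  x₁_lt : x₁ < g
  x₂_lt : x₂ < g
  x₃_lt : x₃ < g
  y_lt : y < g
  hilbertSeries_mul :
    hilbertSeries d₁ d₂ d₃ * ((1 - X ^ d₁) * (1 - X ^ d₂) * (1 - X ^ d₃)) =
      (1 - X ^ x₁ - X ^ x₂ - X ^ x₃ + X ^ y + X ^ g : PowerSeries ℤ)

end ThreeGen

end

/-! ### The semigroup, its gaps, and the degree of the numerator. -/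

namespace ThreeGen

open Finset

/-! Write Γ for the gap polynomial and π = d₁d₂d₃. Multiplying the Hilbert series by 1 - t gives a
polynomial identity between Γ and the numerator (`polynomial_identity`). Its degree yields g = g₃.
Substituting t = exp z and reading off the coefficients of z, …, z⁴ expresses the power sums of the
degrees through π, K₀, K₁ (`power_sums`). The first three determine the elementary symmetric
functions of the x's, hence the fourth, which is the identity for K₁ (`twelve_mul_K1`).

Degrees exist because the Apéry set of d₁ is indexed by an L-shaped set of pairs
(`exists_isNormal_iff`), a difference of two rectangles. This construction also gives xⱼ ≤ y < g. In
the nonnegative variables y - xⱼ and g - y the bounds on h₁ become elementary inequalities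
(`h1_bounds`). -/

theorem mem_semigroup_iff {d₁ d₂ d₃ n : ℕ} :
    n ∈ semigroup d₁ d₂ d₃ ↔ ∃ i j k, n = i * d₁ + j * d₂ + k * d₃ := by
  constructor
  · intro h
    rw [semigroup] at h
    induction h using AddSubmonoid.closure_induction with
    | mem x hx =>
      rcases hx with rfl | rfl | rfl
      · exact ⟨1, 0, 0, by simp⟩
      · exact ⟨0, 1, 0, by simp⟩
      · exact ⟨0, 0, 1, by simp⟩
    | zero => exact ⟨0, 0, 0, by simp⟩
    | add x y _ _ hx hy =>
      obtain ⟨i, j, k, rfl⟩ := hx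
      obtain ⟨i', j', k', rfl⟩ := hy
      exact ⟨i + i', j + j', k + k', by ring⟩
  · rintro ⟨i, j, k, rfl⟩
    have h : ∀ (m : ℕ) {d : ℕ}, d ∈ ({d₁, d₂, d₃} : Set ℕ) → m * d ∈ semigroup d₁ d₂ d₃ :=
      fun m d hd => smul_eq_mul m d ▸ nsmul_mem (show d ∈ semigroup d₁ d₂ d₃ from
        AddSubmonoid.subset_closure hd) m
    exact add_mem (add_mem (h i (by simp)) (h j (by simp))) (h k (by simp))

theorem finite_gaps {d₁ d₂ d₃ : ℕ} (h : Nat.gcd (Nat.gcd d₁ d₂) d₃ = 1) :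
    (gaps d₁ d₂ d₃).Finite := by
  obtain ⟨n, hn⟩ := Nat.exists_mem_closure_of_ge ({d₁, d₂, d₃} : Set ℕ)
  refine (Set.finite_lt_nat n).subset fun m hm => ?_
  by_contra hlt
  refine hm.2 (hn m (not_lt.mp hlt) ?_)
  have h1 : Nat.setGcd ({d₁, d₂, d₃} : Set ℕ) = 1 := by
    refine Nat.dvd_one.mp (h ▸ Nat.dvd_gcd (Nat.dvd_gcd ?_ ?_) ?_) <;>
      exact Nat.setGcd_dvd_of_mem (by simp)
  simp [h1]

theorem one_mem_gaps {d₁ d₂ d₃ : ℕ} (hd : IsMinimallyGenerated d₁ d₂ d₃) :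
    1 ∈ gaps d₁ d₂ d₃ := by
  refine ⟨one_pos, fun h => ?_⟩
  obtain ⟨i, j, k, h⟩ := mem_semigroup_iff.mp h
  have h1 := hd.three_le
  have h2 := hd.lt₁₂
  have h3 := hd.lt₂₃
  rcases i with _ | i
  · rcases j with _ | j
    · rcases k with _ | k
      · simp at h
      · nlinarith
    · nlinarith
  · nlinarith [Nat.zero_le (j * d₂), Nat.zero_le (k * d₃), Nat.zero_le (i * d₁)]

theorem frobenius_mem_gaps {d₁ d₂ d₃ : ℕ} (hd : IsMinimallyGenerated d₁ d₂ d₃) :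
    frobenius d₁ d₂ d₃ ∈ gaps d₁ d₂ d₃ :=
  Nat.sSup_mem ⟨1, one_mem_gaps hd⟩ (finite_gaps hd.gcd_eq_one).bddAbove

theorem le_frobenius {d₁ d₂ d₃ s : ℕ} (hd : IsMinimallyGenerated d₁ d₂ d₃)
    (hs : s ∈ gaps d₁ d₂ d₃) : s ≤ frobenius d₁ d₂ d₃ :=
  le_csSup (finite_gaps hd.gcd_eq_one).bddAbove hs

section GapPolynomial

variable {d₁ d₂ d₃ : ℕ} {Δ : Finset ℕ}

open PowerSeries in
theorem hilbertSeries_mul_one_sub_X (hΔ : ∀ s, s ∈ Δ ↔ s ∈ gaps d₁ d₂ d₃) :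
    hilbertSeries d₁ d₂ d₃ * (1 - X) = 1 - (1 - X) * ∑ s ∈ Δ, X ^ s := by
  have h : hilbertSeries d₁ d₂ d₃ = PowerSeries.mk 1 - ∑ s ∈ Δ, X ^ s := by
    ext n
    simp only [hilbertSeries, coeff_mk, map_sub, map_sum, coeff_X_pow, Pi.one_apply,
      Finset.sum_ite_eq]
    have hn : n ∈ Δ ↔ n ∉ semigroup d₁ d₂ d₃ := by
      rw [hΔ]
      refine ⟨And.right, fun h => ⟨Nat.pos_of_ne_zero ?_, h⟩⟩
      rintro rfl
      exact h (zero_mem _)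
    by_cases hs : n ∈ semigroup d₁ d₂ d₃
    · simp [hs, show n ∉ Δ from fun h => hn.mp h hs]
    · simp [hs, hn.mpr hs]
  rw [h, sub_mul, PowerSeries.mk_one_mul_one_sub_eq_one, mul_comm (1 - X)]

open Polynomial in
theorem IsSyzygyDegrees.polynomial_identity {x₁ x₂ x₃ y g : ℕ}
    (h : IsSyzygyDegrees d₁ d₂ d₃ x₁ x₂ x₃ y g) (hΔ : ∀ s, s ∈ Δ ↔ s ∈ gaps d₁ d₂ d₃) :
    (1 - (1 - X) * ∑ s ∈ Δ, X ^ s) * ((1 - X ^ d₁) * (1 - X ^ d₂) * (1 - X ^ d₃)) =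
      ((1 - X) * (1 - X ^ x₁ - X ^ x₂ - X ^ x₃ + X ^ y + X ^ g) : ℤ[X]) := by
  have hs : ((∑ s ∈ Δ, X ^ s : ℤ[X]) : PowerSeries ℤ) = ∑ s ∈ Δ, PowerSeries.X ^ s := by
    rw [← Polynomial.coeToPowerSeries.ringHom_apply, map_sum]
    simp
  apply Polynomial.coe_injective
  push_cast
  rw [hs, ← hilbertSeries_mul_one_sub_X hΔ, ← h.hilbertSeries_mul]
  ring

open Polynomial in
-- Compare degrees in `polynomial_identity`: the gap factor has degree F₃ + 1, and the numerator has
-- degree g since all its other exponents are smaller.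
theorem IsSyzygyDegrees.eq_g3 {x₁ x₂ x₃ y g : ℕ} (hd : IsMinimallyGenerated d₁ d₂ d₃)
    (h : IsSyzygyDegrees d₁ d₂ d₃ x₁ x₂ x₃ y g) : g = g3 d₁ d₂ d₃ := by
  have hΔ : ∀ s, s ∈ (finite_gaps hd.gcd_eq_one).toFinset ↔ s ∈ gaps d₁ d₂ d₃ := by simp
  have key := h.polynomial_identity hΔ
  set Δ := (finite_gaps hd.gcd_eq_one).toFinset
  have hF := frobenius_mem_gaps hd
  have hpow : ∀ n : ℕ, (1 - X ^ n : ℤ[X]).natDegree = n := fun n => by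
    rw [← natDegree_neg, neg_sub]
    simpa using natDegree_X_pow_sub_C (n := n) (r := (1 : ℤ))
  have hX : (1 - X : ℤ[X]).natDegree = 1 := by simpa using hpow 1
  have hne : ∀ p : ℤ[X], p.natDegree ≠ 0 → p ≠ 0 := fun p hp h0 => hp (by simp [h0])
  have hd1 := hd.three_le
  have hd2 := hd.lt₁₂
  have hd3 := hd.lt₂₃
  have hsum : (∑ s ∈ Δ, X ^ s : ℤ[X]).natDegree = frobenius d₁ d₂ d₃ := by
    refine natDegree_eq_of_le_of_coeff_ne_zero (natDegree_sum_le_of_forall_le _ _ fun s hs => ?_) ?_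
    · simpa using le_frobenius hd ((hΔ s).mp hs)
    · simp [coeff_X_pow, hΔ, hF]
  have hsum0 : (∑ s ∈ Δ, X ^ s : ℤ[X]) ≠ 0 := hne _ (by rw [hsum]; exact hF.1.ne')
  have hA : (1 - (1 - X) * ∑ s ∈ Δ, X ^ s : ℤ[X]).natDegree = 1 + frobenius d₁ d₂ d₃ := by
    have h1 : ((1 - X) * ∑ s ∈ Δ, X ^ s : ℤ[X]).natDegree = 1 + frobenius d₁ d₂ d₃ := by
      rw [natDegree_mul (hne _ (by simp [hX])) hsum0, hX, hsum]
    rw [natDegree_sub_eq_right_of_natDegree_lt (by rw [h1]; simp), h1]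
  have hg : (1 - X ^ x₁ - X ^ x₂ - X ^ x₃ + X ^ y + X ^ g : ℤ[X]).natDegree = g := by
    have hx1 := h.x₁_lt
    have hx2 := h.x₂_lt
    have hx3 := h.x₃_lt
    have hy := h.y_lt
    refine natDegree_eq_of_le_of_coeff_ne_zero ?_ ?_
    · compute_degree
      omega
    · simp [coeff_X_pow, coeff_one, hx1.ne', hx2.ne', hx3.ne', hy.ne',
        (show g ≠ 0 by omega)]
  have h1 : ∀ n, 0 < n → (1 - X ^ n : ℤ[X]) ≠ 0 := fun n hn => hne _ (by rw [hpow]; omega)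
  have h2 := congrArg natDegree key
  have hg0 : 0 < g := by have := h.y_lt; omega
  rw [natDegree_mul (hne _ (by omega)) (mul_ne_zero (mul_ne_zero (h1 _ (by omega))
      (h1 _ (by omega))) (h1 _ (by omega))),
    natDegree_mul (mul_ne_zero (h1 _ (by omega)) (h1 _ (by omega))) (h1 _ (by omega)),
    natDegree_mul (h1 _ (by omega)) (h1 _ (by omega)),
    natDegree_mul (hne _ (by simp [hX])) (hne _ (by omega)), hA, hX, hg, hpow, hpow, hpow] at h2
  unfold g3
  omega

end GapPolynomial

end ThreeGen

/-! ### Power sums of the syzygy degrees, via t = exp z. -/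

namespace ThreeGen

open Finset

/-- The power series `(exp (n z) - 1) / z`. -/
noncomputable def expQuot (n : ℕ) : PowerSeries ℝ :=
  PowerSeries.mk fun k => (n : ℝ) ^ (k + 1) / (k + 1).factorial

theorem exp_pow_eq (n : ℕ) :
    PowerSeries.exp ℝ ^ n = 1 + PowerSeries.X * expQuot n := by
  rw [PowerSeries.exp_pow_eq_rescale_exp]
  ext k
  cases k with
  | zero => simp
  | succ k =>
    simp [PowerSeries.coeff_succ_X_mul, PowerSeries.coeff_rescale, PowerSeries.coeff_exp,
      PowerSeries.coeff_one, expQuot, div_eq_mul_inv]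

theorem coeff_exp_pow (n k : ℕ) :
    PowerSeries.coeff k (PowerSeries.exp ℝ ^ n) = (n : ℝ) ^ k / k.factorial := by
  simp [PowerSeries.exp_pow_eq_rescale_exp, PowerSeries.coeff_rescale, PowerSeries.coeff_exp,
    div_eq_mul_inv]

theorem G_eq_sum {d₁ d₂ d₃ : ℕ} {Δ : Finset ℕ} (hΔ : ∀ s, s ∈ Δ ↔ s ∈ gaps d₁ d₂ d₃) (r : ℕ) :
    G d₁ d₂ d₃ r = ∑ s ∈ Δ, (s : ℝ) ^ r := by
  have : gaps d₁ d₂ d₃ = Δ := by ext s; simp [hΔ]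
  rw [G, this, finsum_mem_coe_finset]

open PowerSeries in
-- Each factor 1 - exp(dz) contributes one z: three on the left against one on the right, hence the
-- remaining `X ^ 2`.
theorem IsSyzygyDegrees.exp_identity {d₁ d₂ d₃ x₁ x₂ x₃ y g : ℕ} {Δ : Finset ℕ}
    (h : IsSyzygyDegrees d₁ d₂ d₃ x₁ x₂ x₃ y g) (hΔ : ∀ s, s ∈ Δ ↔ s ∈ gaps d₁ d₂ d₃) :
    X ^ 2 * ((1 + X * (expQuot 1 * ∑ s ∈ Δ, exp ℝ ^ s)) *
        (expQuot d₁ * (expQuot d₂ * expQuot d₃))) =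
      expQuot 1 * (1 - exp ℝ ^ x₁ - exp ℝ ^ x₂ - exp ℝ ^ x₃ + exp ℝ ^ y + exp ℝ ^ g) := by
  have key := congrArg (Polynomial.aeval (exp ℝ)) (h.polynomial_identity hΔ)
  simp only [map_mul, map_sub, map_one, map_add, map_pow, map_sum, Polynomial.aeval_X] at key
  have h1 : exp ℝ = 1 + X * expQuot 1 := by simpa using exp_pow_eq 1
  generalize hs : ∑ s ∈ Δ, exp ℝ ^ s = Γ at key ⊢
  generalize hp : 1 - exp ℝ ^ x₁ - exp ℝ ^ x₂ - exp ℝ ^ x₃ + exp ℝ ^ y + exp ℝ ^ g = P at key ⊢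
  rw [exp_pow_eq d₁, exp_pow_eq d₂, exp_pow_eq d₃, h1] at key
  have hX : (X : PowerSeries ℝ) ≠ 0 := PowerSeries.X_ne_zero
  apply mul_left_cancel₀ hX
  linear_combination -key

open PowerSeries in
/-- The power sums of the syzygy degrees, expressed by the generators and the genera. -/
theorem IsSyzygyDegrees.power_sums {d₁ d₂ d₃ x₁ x₂ x₃ y g : ℕ}
    (hd : IsMinimallyGenerated d₁ d₂ d₃) (h : IsSyzygyDegrees d₁ d₂ d₃ x₁ x₂ x₃ y g) :
    (x₁ + x₂ + x₃ : ℝ) = y + g ∧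
    (y ^ 2 + g ^ 2 - (x₁ ^ 2 + x₂ ^ 2 + x₃ ^ 2) : ℝ) = 2 * (d₁ * d₂ * d₃) ∧
    (y ^ 3 + g ^ 3 - (x₁ ^ 3 + x₂ ^ 3 + x₃ ^ 3) : ℝ) = 6 * (d₁ * d₂ * d₃) * K0 d₁ d₂ d₃ ∧
    (y ^ 4 + g ^ 4 - (x₁ ^ 4 + x₂ ^ 4 + x₃ ^ 4) : ℝ) = 24 * (d₁ * d₂ * d₃) * K1 d₁ d₂ d₃ := by
  have hΔ : ∀ s, s ∈ (finite_gaps hd.gcd_eq_one).toFinset ↔ s ∈ gaps d₁ d₂ d₃ := by simp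
  have key := h.exp_identity hΔ
  have hG0 := G_eq_sum hΔ 0
  have hG1 := G_eq_sum hΔ 1
  set Δ := (finite_gaps hd.gcd_eq_one).toFinset
  have hΓ0 : coeff 0 (∑ s ∈ Δ, exp ℝ ^ s) = G d₁ d₂ d₃ 0 := by
    rw [hG0, map_sum]; exact sum_congr rfl fun s _ => by rw [coeff_exp_pow]; simp
  have hΓ1 : coeff 1 (∑ s ∈ Δ, exp ℝ ^ s) = G d₁ d₂ d₃ 1 := by
    rw [hG1, map_sum]; exact sum_congr rfl fun s _ => by rw [coeff_exp_pow]; simp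
  have hP : ∀ k, coeff (k + 1)
      (1 - exp ℝ ^ x₁ - exp ℝ ^ x₂ - exp ℝ ^ x₃ + exp ℝ ^ y + exp ℝ ^ g) =
      ((y : ℝ) ^ (k + 1) + g ^ (k + 1) - (x₁ ^ (k + 1) + x₂ ^ (k + 1) + x₃ ^ (k + 1))) /
        (k + 1).factorial := fun k => by
    simp only [map_add, map_sub, coeff_exp_pow, coeff_one, Nat.succ_ne_zero, if_false]
    ring
  have hP0 : coeff 0 (1 - exp ℝ ^ x₁ - exp ℝ ^ x₂ - exp ℝ ^ x₃ + exp ℝ ^ y + exp ℝ ^ g) =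
      (0 : ℝ) := by
    simp only [map_add, map_sub, coeff_exp_pow, coeff_one]
    norm_num
  have hP1 := hP 0
  have hP2 := hP 1
  have hP3 := hP 2
  have hP4 := hP 3
  generalize ∑ s ∈ Δ, exp ℝ ^ s = Γ at *
  generalize 1 - exp ℝ ^ x₁ - exp ℝ ^ x₂ - exp ℝ ^ x₃ + exp ℝ ^ y + exp ℝ ^ g = P at *
  have hq : ∀ n k, coeff k (expQuot n) = (n : ℝ) ^ (k + 1) / (k + 1).factorial := fun n k => by
    rw [expQuot, coeff_mk]
  have hX1 : ∀ k (A : PowerSeries ℝ), coeff (k + 1) (X * A) = coeff k A :=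
    fun k A => coeff_succ_X_mul k A
  have hX0 : ∀ A : PowerSeries ℝ, coeff 0 (X * A) = 0 := fun A => by simp
  have c1 := congrArg (coeff 1) key
  have c2 := congrArg (coeff 2) key
  have c3 := congrArg (coeff 3) key
  have c4 := congrArg (coeff 4) key
  rw [pow_two, mul_assoc] at c1 c2 c3 c4
  rw [hX1 0, hX0] at c1
  rw [hX1 1, hX1 0] at c2
  rw [hX1 2, hX1 1] at c3
  rw [hX1 3, hX1 2] at c4
  have a1 : antidiagonal 1 = {(0, 1), (1, 0)} := rfl
  have a2 : antidiagonal 2 = {(0, 2), (1, 1), (2, 0)} := rfl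
  have a3 : antidiagonal 3 = {(0, 3), (1, 2), (2, 1), (3, 0)} := rfl
  have a4 : antidiagonal 4 = {(0, 4), (1, 3), (2, 2), (3, 1), (4, 0)} := rfl
  have b1 : ∀ A B : PowerSeries ℝ, coeff 1 (A * B) =
      coeff 0 A * coeff 1 B + coeff 1 A * coeff 0 B := fun A B => by
    rw [coeff_mul, a1]; simp
  have b0 : ∀ A B : PowerSeries ℝ, coeff 0 (A * B) = coeff 0 A * coeff 0 B := fun A B => by
    simp
  have b2 : ∀ A B : PowerSeries ℝ, coeff 2 (A * B) =
      coeff 0 A * coeff 2 B + coeff 1 A * coeff 1 B + coeff 2 A * coeff 0 B := fun A B => by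
    rw [coeff_mul, a2]; simp; ring
  have b3 : ∀ A B : PowerSeries ℝ, coeff 3 (A * B) = coeff 0 A * coeff 3 B +
      coeff 1 A * coeff 2 B + coeff 2 A * coeff 1 B + coeff 3 A * coeff 0 B := fun A B => by
    rw [coeff_mul, a3]; simp; ring
  have b4 : ∀ A B : PowerSeries ℝ, coeff 4 (A * B) = coeff 0 A * coeff 4 B +
      coeff 1 A * coeff 3 B + coeff 2 A * coeff 2 B + coeff 3 A * coeff 1 B +
      coeff 4 A * coeff 0 B := fun A B => by
    rw [coeff_mul, a4]; simp; ring
  have hZ1 : ∀ A : PowerSeries ℝ, coeff 1 (1 + X * A) = coeff 0 A := fun A => by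
    rw [map_add, hX1 0, coeff_one]; simp
  have hZ2 : ∀ A : PowerSeries ℝ, coeff 2 (1 + X * A) = coeff 1 A := fun A => by
    rw [map_add, hX1 1, coeff_one]; simp
  have hZ0 : ∀ A : PowerSeries ℝ, coeff 0 (1 + X * A) = 1 := fun A => by
    rw [map_add, hX0, coeff_one]; simp
  simp only [b0, b1, b2, b3, b4, hZ0, hZ1, hZ2, hq, hP0, hP1, hP2, hP3, hP4, hΓ0, hΓ1]
    at c1 c2 c3 c4
  norm_num [Nat.factorial] at c1 c2 c3 c4
  have e1 : (x₁ + x₂ + x₃ : ℝ) = y + g := by linarith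
  have e2 : (y ^ 2 + g ^ 2 - (x₁ ^ 2 + x₂ ^ 2 + x₃ ^ 2) : ℝ) = 2 * (d₁ * d₂ * d₃) := by
    linear_combination -2 * c2 + e1
  have e3 : (y ^ 3 + g ^ 3 - (x₁ ^ 3 + x₂ ^ 3 + x₃ ^ 3) : ℝ) =
      6 * (d₁ * d₂ * d₃) * K0 d₁ d₂ d₃ := by
    unfold K0 delta sigma
    linear_combination -6 * c3 + e1 - 3 / 2 * e2
  refine ⟨e1, e2, e3, ?_⟩
  unfold K0 delta sigma at e3
  unfold K1 delta sigma
  linear_combination -24 * c4 + e1 - 2 * e2 - 2 * e3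

/-- The identity relating `K₁`, `K₀` and the syzygy degrees. -/
theorem IsSyzygyDegrees.twelve_mul_K1 {d₁ d₂ d₃ x₁ x₂ x₃ y g : ℕ}
    (hd : IsMinimallyGenerated d₁ d₂ d₃) (h : IsSyzygyDegrees d₁ d₂ d₃ x₁ x₂ x₃ y g) :
    12 * K1 d₁ d₂ d₃ = 4 * (y + g) * K0 d₁ d₂ d₃ - 2 * (y * g) - d₁ * d₂ * d₃ := by
  obtain ⟨e1, e2, e3, e4⟩ := h.power_sums hd
  have hd1 := hd.three_le
  have hd2 := hd.lt₁₂
  have hd3 := hd.lt₂₃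
  have hπ : (d₁ * d₂ * d₃ : ℝ) ≠ 0 := by
    have : d₁ * d₂ * d₃ ≠ 0 := by simp; omega
    exact_mod_cast this
  generalize (d₁ * d₂ * d₃ : ℝ) = π at *
  have hx : (x₃ : ℝ) = y + g - x₁ - x₂ := by linarith
  rw [hx] at e2 e3 e4
  apply mul_left_cancel₀ hπ
  -- `f2` and `f3` are the second and third elementary symmetric functions of the x's; Newton's
  -- identity then gives the fourth power sum.
  have f2 : (x₁ * x₂ + (x₁ + x₂) * (y + g - x₁ - x₂) : ℝ) = y * g + π := by
    linear_combination e2 / 2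
  have f3 : (x₁ * x₂ * (y + g - x₁ - x₂) : ℝ) = (y + g) * π - 2 * π * K0 d₁ d₂ d₃ := by
    linear_combination -e3 / 3 + (y + g : ℝ) * f2
  linear_combination -e4 / 2 + 2 * (y + g : ℝ) ^ 2 * f2 - 2 * (y + g : ℝ) * f3 -
    (x₁ * x₂ + (x₁ + x₂) * (y + g - x₁ - x₂) + y * g + π : ℝ) * f2

end ThreeGen

/-! ### The L-shape of minimal representatives modulo m. -/

namespace ThreeGen

open Finset

/-- `(i, j)` is the smallest pair, ordered by the weight `i * u + j * w` and then by `i`, among all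
pairs whose weight has the same residue modulo `m`. -/
def IsNormal (m u w i j : ℕ) : Prop :=
  ∀ i' j' : ℕ, (i' * u + j' * w : ZMod m) = i * u + j * w →
    i * u + j * w < i' * u + j' * w ∨ (i * u + j * w = i' * u + j' * w ∧ i ≤ i')

section Normal

variable {m u w : ℕ}

theorem exists_isNormal (m u w i j : ℕ) : ∃ i' j', IsNormal m u w i' j' ∧
    (i' * u + j' * w : ZMod m) = i * u + j * w ∧
    (i' * u + j' * w < i * u + j * w ∨ (i' * u + j' * w = i * u + j * w ∧ i' ≤ i)) := by
  let key : ℕ × ℕ → ℕ ×ₗ ℕ := fun p => toLex (p.1 * u + p.2 * w, p.1)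
  obtain ⟨⟨i', j'⟩, hmem, hmin⟩ := (InvImage.wf key wellFounded_lt).has_min
    {p : ℕ × ℕ | (p.1 * u + p.2 * w : ZMod m) = i * u + j * w} ⟨(i, j), rfl⟩
  have hle : ∀ k l : ℕ, (k * u + l * w : ZMod m) = i * u + j * w →
      i' * u + j' * w < k * u + l * w ∨ (i' * u + j' * w = k * u + l * w ∧ i' ≤ k) := by
    intro k l h
    have h1 := not_lt.mp (hmin (k, l) h)
    simpa [key, Prod.Lex.toLex_le_toLex] using h1
  exact ⟨i', j', fun k l h => hle k l (h.trans hmem), hmem, hle i j rfl⟩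

theorem IsNormal.eq_of_cast_eq (hw : 0 < w) {i j i' j' : ℕ} (h : IsNormal m u w i j)
    (h' : IsNormal m u w i' j') (heq : (i * u + j * w : ZMod m) = i' * u + j' * w) :
    i = i' ∧ j = j' := by
  have h1 := h i' j' heq.symm
  have h2 := h' i j heq
  obtain rfl : i = i' := by omega
  refine ⟨rfl, Nat.eq_of_mul_eq_mul_right hw ?_⟩
  omega

theorem IsNormal.of_add {i j k l : ℕ} (h : IsNormal m u w (i + k) (j + l)) :
    IsNormal m u w i j := by
  intro i' j' heq
  have h1 := h (i' + k) (j' + l) (by push_cast; linear_combination heq)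
  have e1 : (i + k) * u + (j + l) * w = i * u + j * w + (k * u + l * w) := by ring
  have e2 : (i' + k) * u + (j' + l) * w = i' * u + j' * w + (k * u + l * w) := by ring
  omega

theorem IsNormal.mono {i j i' j' : ℕ} (h : IsNormal m u w i' j') (hi : i ≤ i') (hj : j ≤ j') :
    IsNormal m u w i j := by
  obtain ⟨k, rfl⟩ := Nat.exists_eq_add_of_le hi
  obtain ⟨l, rfl⟩ := Nat.exists_eq_add_of_le hj
  exact h.of_add

/-- If a pair with common part `(k, l)` with a normal pair of its class becomes normal when that
part is removed, then it is itself normal. -/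
theorem IsNormal.add_of_le (hw : 0 < w) {i j i' j' k l : ℕ} (h : IsNormal m u w i j)
    (h' : IsNormal m u w (i' + k) (j' + l))
    (heq : ((i' + k : ℕ) * u + (j' + l : ℕ) * w : ZMod m) = (i + k : ℕ) * u + (j + l : ℕ) * w) :
    IsNormal m u w (i + k) (j + l) := by
  have h1 := h.eq_of_cast_eq hw h'.of_add (by push_cast at heq; linear_combination -heq)
  rwa [h1.1, h1.2]

theorem isNormal_zero : IsNormal m u w 0 0 := by
  intro i j _
  have := Nat.zero_le (i * u + j * w)
  omega

/-- If the normal pair of the class had a positive coordinate, removing one unit of it from both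
pairs would make the corner normal. So that pair is (0, 0). -/
theorem cast_eq_zero_of_corner (hw : 0 < w) {i j : ℕ} (h1 : IsNormal m u w i (j + 1))
    (h2 : IsNormal m u w (i + 1) j) (h : ¬ IsNormal m u w (i + 1) (j + 1)) :
    ((i + 1 : ℕ) * u + (j + 1 : ℕ) * w : ZMod m) = 0 := by
  obtain ⟨k, l, hn, heq, -⟩ := exists_isNormal m u w (i + 1) (j + 1)
  rcases k with _ | k
  · rcases l with _ | l
    · simpa using heq.symm
    · exact absurd (h2.add_of_le (k := 0) (l := 1) hw hn heq) h
  · exact absurd (h1.add_of_le (k := 1) (l := 0) hw hn heq) h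

theorem exists_not_isNormal_left (hm : 0 < m) (hw : 0 < w) : ∃ i, ¬ IsNormal m u w i 0 :=
  ⟨m, fun h => hm.ne' (h.eq_of_cast_eq hw isNormal_zero (by simp)).1⟩

theorem exists_not_isNormal_right (hm : 0 < m) (hw : 0 < w) : ∃ j, ¬ IsNormal m u w 0 j :=
  ⟨m, fun h => hm.ne' (h.eq_of_cast_eq hw isNormal_zero (by simp)).2⟩

/-- The normal pairs form an L-shape; its degenerate form is a rectangle. -/
theorem exists_isNormal_iff (hm : 0 < m) (hw : 0 < w) : ∃ a b p q : ℕ, 0 < a ∧ 0 < b ∧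
    p ≤ a ∧ q ≤ b ∧ (∀ i j, IsNormal m u w i j ↔ (i < a ∧ j < b) ∧ ¬ (p ≤ i ∧ q ≤ j)) ∧
    (p = a ∨ (0 < p ∧ 0 < q ∧ (a - p) * u ≤ b * w ∧ (b - q) * w ≤ a * u ∧
      (a - p) * u ≠ (b - q) * w)) := by
  classical
  have exA := exists_not_isNormal_left (u := u) hm hw
  have exB := exists_not_isNormal_right (u := u) hm hw
  obtain ⟨a, ha, hamin⟩ : ∃ a, ¬ IsNormal m u w a 0 ∧ ∀ i < a, IsNormal m u w i 0 :=
    ⟨Nat.find exA, Nat.find_spec exA, fun i hi => not_not.mp (Nat.find_min exA hi)⟩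
  obtain ⟨b, hb, hbmin⟩ : ∃ b, ¬ IsNormal m u w 0 b ∧ ∀ j < b, IsNormal m u w 0 j :=
    ⟨Nat.find exB, Nat.find_spec exB, fun i hi => not_not.mp (Nat.find_min exB hi)⟩
  have ha0 : 0 < a := Nat.pos_of_ne_zero fun h => ha (by rw [h]; exact isNormal_zero)
  have hb0 : 0 < b := Nat.pos_of_ne_zero fun h => hb (by rw [h]; exact isNormal_zero)
  have hlt : ∀ i j, IsNormal m u w i j → i < a ∧ j < b := fun i j h =>
    ⟨not_le.mp fun hi => ha (h.mono hi (Nat.zero_le _)),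
      not_le.mp fun hj => hb (h.mono (Nat.zero_le _) hj)⟩
  by_cases hrect : ∀ i j, i < a → j < b → IsNormal m u w i j
  · exact ⟨a, b, a, 0, ha0, hb0, le_rfl, Nat.zero_le _, fun i j =>
      ⟨fun h => ⟨hlt i j h, by have := hlt i j h; omega⟩, fun h => hrect i j h.1.1 h.1.2⟩,
      Or.inl rfl⟩
  push Not at hrect
  have exP : ∃ p, ∃ j, p < a ∧ j < b ∧ ¬ IsNormal m u w p j := hrect
  obtain ⟨p, ⟨j₀, hpa, hj₀b, hj₀⟩, hpmin⟩ : ∃ p, (∃ j, p < a ∧ j < b ∧ ¬ IsNormal m u w p j) ∧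
      ∀ i < p, ∀ j < b, IsNormal m u w i j := by
    refine ⟨Nat.find exP, Nat.find_spec exP, fun i hi j hj => ?_⟩
    by_contra hn
    have hfa := (Nat.find_spec exP).choose_spec.1
    exact Nat.find_min exP hi ⟨j, hi.trans hfa, hj, hn⟩
  have exQ : ∃ q, ¬ IsNormal m u w p q := ⟨j₀, hj₀⟩
  obtain ⟨q, hq, hqmin⟩ : ∃ q, ¬ IsNormal m u w p q ∧ ∀ j < q, IsNormal m u w p j :=
    ⟨Nat.find exQ, Nat.find_spec exQ, fun i hi => not_not.mp (Nat.find_min exQ hi)⟩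
  have hqb : q < b := lt_of_le_of_lt (not_lt.mp fun h => hj₀ (hqmin _ h)) hj₀b
  have hp0 : 0 < p := Nat.pos_of_ne_zero fun h => hq (h ▸ hbmin q hqb)
  have hq0 : 0 < q := Nat.pos_of_ne_zero fun h => hq (h ▸ hamin p hpa)
  have hcorner : ∀ k l, 0 < k → 0 < l → IsNormal m u w (k - 1) l → IsNormal m u w k (l - 1) →
      ¬ IsNormal m u w k l → (k * u + l * w : ZMod m) = 0 := by
    intro k l hk hl h1 h2 h3
    obtain ⟨k, rfl⟩ := Nat.exists_eq_succ_of_ne_zero hk.ne'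
    obtain ⟨l, rfl⟩ := Nat.exists_eq_succ_of_ne_zero hl.ne'
    exact cast_eq_zero_of_corner hw h1 h2 h3
  have hpq : (p * u + q * w : ZMod m) = 0 :=
    hcorner p q hp0 hq0 (hpmin _ (by omega) _ hqb) (hqmin _ (by omega)) hq
  have hiff : ∀ i j, IsNormal m u w i j ↔ (i < a ∧ j < b) ∧ ¬ (p ≤ i ∧ q ≤ j) := by
    refine fun i j => ⟨fun h => ⟨hlt i j h, fun h' => hq (h.mono h'.1 h'.2)⟩, fun ⟨⟨hi, hj⟩, h⟩ => ?_⟩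
    by_contra hn
    have hpi : p ≤ i := not_lt.mp fun h' => hn (hpmin i h' j hj)
    have hjq : j < q := by omega
    have exK : ∃ k, ¬ IsNormal m u w k j := ⟨i, hn⟩
    obtain ⟨k, hk, hkmin⟩ : ∃ k, ¬ IsNormal m u w k j ∧ ∀ i < k, IsNormal m u w i j :=
      ⟨Nat.find exK, Nat.find_spec exK, fun i hi => not_not.mp (Nat.find_min exK hi)⟩
    have hki : k ≤ i := not_lt.mp fun h' => hn (hkmin _ h')
    have hpk : p < k := not_le.mp fun h' => hk ((hqmin j hjq).mono h' le_rfl)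
    have exL : ∃ l, ¬ IsNormal m u w k l := ⟨j, hk⟩
    obtain ⟨l, hl, hlmin⟩ : ∃ l, ¬ IsNormal m u w k l ∧ ∀ j < l, IsNormal m u w k j :=
      ⟨Nat.find exL, Nat.find_spec exL, fun i hi => not_not.mp (Nat.find_min exL hi)⟩
    have hlj : l ≤ j := not_lt.mp fun h' => hk (hlmin _ h')
    have hl0 : 0 < l := Nat.pos_of_ne_zero fun h' => hl (h' ▸ hamin k (by omega))
    have hkl := hcorner k l (by omega) hl0 ((hkmin (k - 1) (by omega)).mono le_rfl hlj)
      (hlmin _ (by omega)) hl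
    -- A second corner (k, l) would put normal pairs from different axes, (k - p, 0) and (0, q - l),
    -- in one class.
    have h1 := (hamin (k - p) (by omega)).eq_of_cast_eq hw (hbmin (q - l) (by omega)) (by
      rw [Nat.cast_sub hpk.le, Nat.cast_sub (by omega : l ≤ q)]
      push_cast
      linear_combination hkl - hpq)
    omega
  -- The normal forms of (a, 0) and (0, b) lie on the opposite axes. Comparison with pu + qw ≡ 0
  -- forces them to be (0, b - q) and (a - p, 0); minimality of weight gives the two inequalities.
  obtain ⟨i₁, r, hr, hreq, hrle⟩ := exists_isNormal m u w a 0
  obtain ⟨s, j₁, hs, hseq, hsle⟩ := exists_isNormal m u w 0 b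
  obtain rfl : i₁ = 0 := by
    by_contra h0
    obtain ⟨k, rfl⟩ := Nat.exists_eq_succ_of_ne_zero h0
    obtain ⟨c, rfl⟩ := Nat.exists_eq_succ_of_ne_zero ha0.ne'
    exact ha ((hamin c (by omega)).add_of_le (k := 1) (l := 0) hw hr hreq)
  obtain rfl : j₁ = 0 := by
    by_contra h0
    obtain ⟨k, rfl⟩ := Nat.exists_eq_succ_of_ne_zero h0
    obtain ⟨c, rfl⟩ := Nat.exists_eq_succ_of_ne_zero hb0.ne'
    exact hb ((hbmin c (by omega)).add_of_le (k := 0) (l := 1) hw hs hseq)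
  have hrb := (hlt _ _ hr).2
  have hsa := (hlt _ _ hs).1
  have hap := hamin (a - p) (by omega)
  push_cast at hreq hseq
  have hqr : b ≤ q + r := by
    by_contra hcon
    have h1 := hap.eq_of_cast_eq hw (hbmin (q + r) (by omega)) (by
      rw [Nat.cast_sub hpa.le]
      push_cast
      linear_combination -hreq - hpq)
    omega
  have h1 := hap.eq_of_cast_eq hw ((hiff s (q + r - b)).mpr (by omega)) (by
    rw [Nat.cast_sub hpa.le, Nat.cast_sub hqr]
    push_cast
    linear_combination -hreq - hseq - hpq)
  obtain rfl : s = a - p := h1.1.symm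
  obtain rfl : r = b - q := by omega
  refine ⟨a, b, p, q, ha0, hb0, hpa.le, hqb.le, hiff, Or.inr ⟨hp0, hq0, by omega, by omega, ?_⟩⟩
  intro heq
  have h2 := hap.eq_of_cast_eq hw hr (by
    have := congrArg (Nat.cast : ℕ → ZMod m) heq
    push_cast at this ⊢
    linear_combination this)
  omega

end Normal

/-! ### Existence of syzygy degrees. -/

section Existence

variable {d₁ d₂ d₃ : ℕ}

open PowerSeries in
-- Both sides enumerate the Apéry set: the n in the semigroup with n - d₁ outside it are the weights
-- of normal pairs, one for each pair.
theorem hilbertSeries_mul_one_sub_X_pow (h₁ : 0 < d₁) (h₃ : 0 < d₃) {L : Finset (ℕ × ℕ)}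
    (hL : ∀ i j, (i, j) ∈ L ↔ IsNormal d₁ d₂ d₃ i j) :
    hilbertSeries d₁ d₂ d₃ * (1 - X ^ d₁) = ∑ z ∈ L, X ^ (z.1 * d₂ + z.2 * d₃) := by
  ext n
  simp only [hilbertSeries, mul_sub, mul_one, map_sub, map_sum, coeff_mul_X_pow', coeff_mk,
    coeff_X_pow]
  by_cases hn : ∃ z ∈ L, n = z.1 * d₂ + z.2 * d₃
  · obtain ⟨⟨i, j⟩, hz, rfl⟩ := hn
    have hnorm := (hL i j).mp hz
    rw [Finset.sum_eq_single_of_mem (i, j) hz]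
    · have h1 : i * d₂ + j * d₃ ∈ semigroup d₁ d₂ d₃ := mem_semigroup_iff.mpr ⟨0, i, j, by ring⟩
      have h2 : d₁ ≤ i * d₂ + j * d₃ → i * d₂ + j * d₃ - d₁ ∉ semigroup d₁ d₂ d₃ := by
        intro hle hmem
        obtain ⟨k, i', j', h⟩ := mem_semigroup_iff.mp hmem
        have h4 : i * d₂ + j * d₃ = (k + 1) * d₁ + i' * d₂ + j' * d₃ := by
          rw [add_mul]; omega
        have h3 := hnorm i' j' (by
          have := congrArg (Nat.cast : ℕ → ZMod d₁) h4
          push_cast at this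
          rw [this]
          simp)
        have := Nat.zero_le (k * d₁)
        omega
      by_cases hle : d₁ ≤ i * d₂ + j * d₃
      · simp [h1, hle, h2 hle]
      · simp [h1, hle]
    · rintro ⟨i', j'⟩ hz' hne
      refine if_neg fun heq => hne ?_
      have h1 := ((hL i' j').mp hz').eq_of_cast_eq h₃ hnorm (by exact_mod_cast congrArg _ heq.symm)
      rw [h1.1, h1.2]
  · rw [Finset.sum_eq_zero fun z hz => if_neg fun h => hn ⟨z, hz, h⟩]
    have hiff : n ∈ semigroup d₁ d₂ d₃ ↔ d₁ ≤ n ∧ n - d₁ ∈ semigroup d₁ d₂ d₃ := by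
      constructor
      · intro h
        obtain ⟨k, i, j, h⟩ := mem_semigroup_iff.mp h
        suffices ∃ k i j, n = (k + 1) * d₁ + i * d₂ + j * d₃ by
          obtain ⟨k, i, j, h⟩ := this
          rw [add_mul] at h
          exact ⟨by omega, mem_semigroup_iff.mpr ⟨k, i, j, by omega⟩⟩
        rcases k with _ | k
        · obtain ⟨i', j', hnorm, heq, hle⟩ := exists_isNormal d₁ d₂ d₃ i j
          have h1 : i' * d₂ + j' * d₃ ≤ i * d₂ + j * d₃ := by omega
          have h2 : i' * d₂ + j' * d₃ ≡ i * d₂ + j * d₃ [MOD d₁] := by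
            rw [← ZMod.natCast_eq_natCast_iff]
            exact_mod_cast heq
          obtain ⟨c, hc⟩ := (Nat.modEq_iff_dvd' h1).mp h2
          rcases c with _ | c
          · exact absurd ⟨(i', j'), (hL i' j').mpr hnorm, by simp at hc ⊢; omega⟩ hn
          · exact ⟨c, i', j', by rw [mul_comm (c + 1)]; omega⟩
        · exact ⟨k, i, j, h⟩
      · rintro ⟨hle, h⟩
        obtain ⟨k, i, j, h⟩ := mem_semigroup_iff.mp h
        exact mem_semigroup_iff.mpr ⟨k + 1, i, j, by rw [add_mul]; omega⟩
    by_cases h : n ∈ semigroup d₁ d₂ d₃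
    · simp [h, (hiff.mp h).1, (hiff.mp h).2]
    · by_cases hle : d₁ ≤ n
      · simp [h, hle, show n - d₁ ∉ semigroup d₁ d₂ d₃ from fun h' => h (hiff.mpr ⟨hle, h'⟩)]
      · simp [h, hle]

theorem sum_rectangle_mul {R : Type*} [CommRing R] (t : R) {a b p q u w : ℕ} (hp : p ≤ a)
    (hq : q ≤ b) :
    (∑ z ∈ Ico p a ×ˢ Ico q b, t ^ (z.1 * u + z.2 * w)) * ((1 - t ^ u) * (1 - t ^ w)) =
      (t ^ (p * u) - t ^ (a * u)) * (t ^ (q * w) - t ^ (b * w)) := by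
  have h : ∑ z ∈ Ico p a ×ˢ Ico q b, t ^ (z.1 * u + z.2 * w) =
      (∑ i ∈ Ico p a, (t ^ u) ^ i) * ∑ j ∈ Ico q b, (t ^ w) ^ j := by
    rw [sum_mul_sum, sum_product]
    refine sum_congr rfl fun i _ => sum_congr rfl fun j _ => ?_
    rw [pow_add, mul_comm i, mul_comm j, pow_mul, pow_mul]
  rw [h, mul_mul_mul_comm, geom_sum_Ico_mul_neg _ hp, geom_sum_Ico_mul_neg _ hq]
  simp only [← pow_mul, mul_comm]

theorem exists_isSyzygyDegrees (h₁ : 0 < d₁) (h₂ : 0 < d₂) (h₃ : 0 < d₃) :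
    ∃ x₁ x₂ x₃ y g : ℕ, 0 < x₁ ∧ 0 < x₂ ∧ 0 < x₃ ∧ x₁ ≤ y ∧ x₂ ≤ y ∧ x₃ ≤ y ∧
      IsSyzygyDegrees d₁ d₂ d₃ x₁ x₂ x₃ y g := by
  obtain ⟨a, b, p, q, ha, hb, hpa, hqb, hiff, hcase⟩ := exists_isNormal_iff (u := d₂) h₁ h₃
  have hsub : Ico p a ×ˢ Ico q b ⊆ Ico 0 a ×ˢ Ico 0 b :=
    product_subset_product (Ico_subset_Ico_left (Nat.zero_le _))
      (Ico_subset_Ico_left (Nat.zero_le _))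
  have hH := hilbertSeries_mul_one_sub_X_pow (d₂ := d₂) h₁ h₃
    (L := (Ico 0 a ×ˢ Ico 0 b) \ (Ico p a ×ˢ Ico q b)) (fun i j => by
      simp only [hiff, mem_sdiff, mem_product, mem_Ico]
      omega)
  have key : hilbertSeries d₁ d₂ d₃ *
      ((1 - PowerSeries.X ^ d₁) * (1 - PowerSeries.X ^ d₂) * (1 - PowerSeries.X ^ d₃)) =
      (1 - PowerSeries.X ^ (a * d₂)) * (1 - PowerSeries.X ^ (b * d₃)) -
      (PowerSeries.X ^ (p * d₂) - PowerSeries.X ^ (a * d₂)) *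
        (PowerSeries.X ^ (q * d₃) - PowerSeries.X ^ (b * d₃)) := by
    rw [mul_assoc, ← mul_assoc, hH, ← sum_rectangle_mul _ hpa hqb]
    have h0 := sum_rectangle_mul (PowerSeries.X : PowerSeries ℤ) (u := d₂) (w := d₃)
      (Nat.zero_le a) (Nat.zero_le b)
    simp only [zero_mul, pow_zero] at h0
    rw [← h0, ← sub_mul, ← sum_sdiff hsub, add_sub_cancel_right]
  have hx₁ : 0 < a * d₂ := Nat.mul_pos ha h₂
  have hx₂ : 0 < b * d₃ := Nat.mul_pos hb h₃
  rcases hcase with rfl | ⟨hp, hq, hs, hr, hne⟩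
  -- Symmetric case: the cancelling pair x₃ = y is the maximum, so that every xⱼ ≤ y, and y < g.
  · refine ⟨p * d₂, b * d₃, max (p * d₂) (b * d₃), max (p * d₂) (b * d₃), p * d₂ + b * d₃,
      hx₁, hx₂, by omega, by omega, by omega, le_rfl, by omega, by omega, by omega, by omega, ?_⟩
    rw [key, pow_add]
    ring
  · have hpd := Nat.mul_pos hp h₂
    have hqd := Nat.mul_pos hq h₃
    have hpa' := Nat.mul_le_mul_right d₂ hpa
    have hqb' := Nat.mul_le_mul_right d₃ hqb
    rw [Nat.sub_mul] at hs hr hne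
    rw [Nat.sub_mul] at hne
    rcases lt_or_ge (a * d₂ + q * d₃) (p * d₂ + b * d₃) with hlt | hge
    · refine ⟨a * d₂, b * d₃, p * d₂ + q * d₃, a * d₂ + q * d₃, p * d₂ + b * d₃, hx₁, hx₂,
        by omega, by omega, by omega, by omega, by omega, by omega, by omega, by omega, ?_⟩
      rw [key]
      simp only [pow_add]
      ring
    · refine ⟨a * d₂, b * d₃, p * d₂ + q * d₃, p * d₂ + b * d₃, a * d₂ + q * d₃, hx₁, hx₂,
        by omega, by omega, by omega, by omega, by omega, by omega, by omega, by omega, ?_⟩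
      rw [key]
      simp only [pow_add]
      ring

end Existence

end ThreeGen

/-! ### Bounds on h₁. -/

namespace ThreeGen

theorem nine_mul_le {A B C : ℝ} (hA : 0 ≤ A) (hB : 0 ≤ B) (hC : 0 ≤ C) :
    9 * (A * B * C) ≤ (A * B + B * C + C * A) * (A + B + C) := by
  linarith [mul_nonneg hA (sq_nonneg (B - C)), mul_nonneg hB (sq_nonneg (C - A)),
    mul_nonneg hC (sq_nonneg (A - B))]

theorem three_mul_lt_sq {A B C D : ℝ} (hA : 0 ≤ A) (hB : 0 ≤ B) (hC : 0 ≤ C) (hD : 0 < D) :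
    3 * (A * B + B * C + C * A + D * (A + B + C + D)) < (A + B + C + 2 * D) ^ 2 := by
  linarith [sq_nonneg (A - B), sq_nonneg (B - C), sq_nonneg (C - A), mul_pos hD hD,
    mul_nonneg hD.le (add_nonneg (add_nonneg hA hB) hC)]

theorem h1_bounds {d₁ d₂ d₃ : ℕ} (hd : IsMinimallyGenerated d₁ d₂ d₃) :
    5 / 36 < h1 d₁ d₂ d₃ ∧ h1 d₁ d₂ d₃ < 11 / 54 := by
  have hd1 := hd.three_le
  have hd2 := hd.lt₁₂
  have hd3 := hd.lt₂₃
  obtain ⟨x₁, x₂, x₃, y, g, -, -, -, hx1, hx2, hx3, h⟩ :=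
    exists_isSyzygyDegrees (d₁ := d₁) (d₂ := d₂) (d₃ := d₃) (by omega) (by omega) (by omega)
  obtain ⟨e1, e2, e3, -⟩ := h.power_sums hd
  have hK := h.twelve_mul_K1 hd
  have hyg : (y : ℝ) < g := by exact_mod_cast h.y_lt
  have hπ : (0 : ℝ) < d₁ * d₂ * d₃ := by
    have : 0 < d₁ * d₂ * d₃ := Nat.mul_pos (Nat.mul_pos (by omega) (by omega)) (by omega)
    exact_mod_cast this
  have hg : (0 : ℝ) < g := lt_of_le_of_lt (Nat.cast_nonneg y) hyg
  unfold h1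
  rw [← h.eq_g3 hd, lt_div_iff₀ (by positivity), div_lt_iff₀ (by positivity)]
  generalize (d₁ * d₂ * d₃ : ℝ) = π at *
  obtain ⟨A, hA⟩ : ∃ A : ℝ, A = y - x₁ := ⟨_, rfl⟩
  obtain ⟨B, hB⟩ : ∃ B : ℝ, B = y - x₂ := ⟨_, rfl⟩
  obtain ⟨C, hC⟩ : ∃ C : ℝ, C = y - x₃ := ⟨_, rfl⟩
  obtain ⟨D, hD⟩ : ∃ D : ℝ, D = g - y := ⟨_, rfl⟩
  have hA0 : 0 ≤ A := by rw [hA, sub_nonneg]; exact_mod_cast hx1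
  have hB0 : 0 ≤ B := by rw [hB, sub_nonneg]; exact_mod_cast hx2
  have hC0 : 0 ≤ C := by rw [hC, sub_nonneg]; exact_mod_cast hx3
  have hD0 : 0 < D := by linarith
  have hy' : (y : ℝ) = A + B + C + D := by linarith
  have hg' : (g : ℝ) = A + B + C + 2 * D := by linarith
  have h1' : (x₁ : ℝ) = B + C + D := by linarith
  have h2' : (x₂ : ℝ) = A + C + D := by linarith
  have h3' : (x₃ : ℝ) = A + B + D := by linarith
  rw [hy', hg', h1', h2', h3'] at e2 e3
  rw [hy', hg'] at hK
  rw [hg']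
  have f2 : π = A * B + B * C + C * A + D * (A + B + C + D) := by linear_combination -e2 / 2
  -- E = 2K₀ - g is the excess of 2K₀ over g; the cubic power sum turns into πE = ABC.
  obtain ⟨E, hE⟩ : ∃ E, E = 2 * K0 d₁ d₂ d₃ - (A + B + C + 2 * D) := ⟨_, rfl⟩
  have f3 : π * E = A * B * C := by
    linear_combination π * hE - e3 / 3 - (A + B + C + 2 * D) * f2
  have hEnn : 0 ≤ E := by
    by_contra hneg
    have := mul_neg_of_pos_of_neg hπ (not_le.mp hneg)
    have := mul_nonneg (mul_nonneg hA0 hB0) hC0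
    linarith
  have hK' : 12 * K1 d₁ d₂ d₃ = 2 * (2 * (A + B + C) + 3 * D) * E +
      2 * (A + B + C + 2 * D) ^ 2 - π := by
    linear_combination hK - 2 * (2 * (A + B + C) + 3 * D) * hE
  have hπle : 3 * π < (A + B + C + 2 * D) ^ 2 := f2 ▸ three_mul_lt_sq hA0 hB0 hC0 hD0
  have hEle : 9 * E ≤ A + B + C + 2 * D := by
    refine le_of_mul_le_mul_left ?_ hπ
    have h10 : (A * B + B * C + C * A) * (A + B + C) ≤ π * (A + B + C + 2 * D) := by
      refine mul_le_mul ?_ (by linarith) (by positivity) hπ.le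
      have : 0 ≤ D * (A + B + C + D) := by positivity
      linarith
    linarith [nine_mul_le hA0 hB0 hC0]
  have hs : 0 ≤ A + B + C := by positivity
  -- With 3π < g² and E ≥ 0, 12K₁ > (2 - 1/3)g² = 12 · (5/36)g². With π > 0 and 9E ≤ g, 12K₁ < (2 +
  -- 4/9)g² = 12 · (11/54)g².
  constructor
  · have : 0 ≤ (2 * (A + B + C) + 3 * D) * E := by positivity
    linarith
  · have : (2 * (A + B + C) + 3 * D) * (9 * E) ≤
        (2 * (A + B + C + 2 * D)) * (A + B + C + 2 * D) :=
      mul_le_mul (by linarith) hEle (by positivity) (by positivity)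
    linarith

end ThreeGen

theorem mainTheorem3 (d₁ d₂ d₃ : ℕ) (hd : ThreeGen.IsMinimallyGenerated d₁ d₂ d₃) :
    (∃ x₁ x₂ x₃ y g : ℕ, 0 < x₁ ∧ 0 < x₂ ∧ 0 < x₃ ∧ 0 < y ∧
      ThreeGen.IsSyzygyDegrees d₁ d₂ d₃ x₁ x₂ x₃ y g) ∧
    (∀ x₁ x₂ x₃ y g : ℕ, ThreeGen.IsSyzygyDegrees d₁ d₂ d₃ x₁ x₂ x₃ y g →
      g = ThreeGen.g3 d₁ d₂ d₃ ∧
      ∀ u : ℝ, u = ((y : ℝ) + (g : ℝ)) / (g : ℝ) →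
        12 * ThreeGen.h1 d₁ d₂ d₃ =
          2 * u * (2 * ThreeGen.h0 d₁ d₂ d₃ - 1) + 2 - ThreeGen.v d₁ d₂ d₃) ∧
    5 / 36 < ThreeGen.h1 d₁ d₂ d₃ ∧ ThreeGen.h1 d₁ d₂ d₃ < 11 / 54 := by
  have hd1 := hd.three_le
  have hd2 := hd.lt₁₂
  have hd3 := hd.lt₂₃
  refine ⟨?_, fun x₁ x₂ x₃ y g h => ⟨h.eq_g3 hd, ?_⟩, ThreeGen.h1_bounds hd⟩
  · obtain ⟨x₁, x₂, x₃, y, g, hx1, hx2, hx3, hy, -, -, h⟩ :=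
      ThreeGen.exists_isSyzygyDegrees (d₁ := d₁) (d₂ := d₂) (d₃ := d₃)
        (by omega) (by omega) (by omega)
    exact ⟨x₁, x₂, x₃, y, g, hx1, hx2, hx3, by omega, h⟩
  · rintro u rfl
    have hg : (g : ℝ) ≠ 0 := by have := h.y_lt; exact_mod_cast (by omega : g ≠ 0)
    have hK := h.twelve_mul_K1 hd
    rw [ThreeGen.h1, ThreeGen.h0, ThreeGen.v, ← h.eq_g3 hd]
    field_simp
    linear_combination hK
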